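/- For a complex number $x$, a positive integer $\ell$ and an integer $m\ge 0$, let $H_m^{\langle \ell\rangle}(x)=\sum_{k=1}^{m}\frac{1}{(x+k)^{\ell}}$ (so $H_0^{\langle\ell\rangle}(x)=0$), and write $H_m(x)=H_m^{\langle 1\rangle}(x)$. For complex $z$ and an integer $m\ge 0$, let $\binom{z}{m}=\frac{z(z-1)\cdots(z-m+1)}{m!}$. Let $n\ge 2$ be an integer and let $x$ be a complex number such that $x\notin\{-1,-2,\dots,-(2n+1)\}$ and $xn+3n+1\neq 0$ (that is, no denominator below vanishes). Then $$\sum_{k=0}^{n}\binom{2n-k}{n}\binom{x+k}{k}k^2H_k^{\langle 2\rangle}(x)=\frac{(x+1)(xn+3n+1)}{8(n-1)}\binom{x+2n+1}{n-2}\Big\{4H_{2n+1}^{\langle 2\rangle}(x)+\tfrac{8(x^2+3x+n^2-n+1)}{n(x+1)(xn+3n+1)}$$ $$-\big[H_n(\tfrac{x}{2})-H_{n+1}(\tfrac{x-1}{2})\big]\big[H_n(\tfrac{x}{2})-H_{n+1}(\tfrac{x-1}{2})-\tfrac{4(x+n+1)(x^2+3x-2n+1)}{n(x+1)(xn+3n+1)}\big]\Big\}.$$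 -/

import Mathlib

/-- The generalized harmonic number of order `l`:
`H_n^{⟨l⟩}(x) = ∑_{k=1}^n 1 / (x + k)^l` for complex `x` (so the value at `n = 0` is `0`). -/
noncomputable def genHarmonic (l n : ℕ) (x : ℂ) : ℂ :=
  ∑ k ∈ Finset.Icc 1 n, 1 / (x + (k : ℂ)) ^ l

open Polynomial Finset

/-! Deform the summand by a variable `y`. With `u_k = binom(x+k,k)/(x+1+k) · ∏_{j≤k} (1 -
y²/(x+j)²)`, the sum is minus the `y²` coefficient of `M_3 + (x+1) M_2`, where `M_i = ∑
binom(2n-k,n) k^i u_k`. Since `u_k` is hypergeometric with parameters `x+1+y`, `x+1-y`; `x+2`,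
telescoping (`sum_contiguous_eq_zero`) reduces `M_2` and `M_3` to `M_0` and `M_1`. Raising the first
parameter by one gives Watson's condition `a+b+1 = 2c`, so `watson_sum_eq_prod` evaluates `M_1 +
(x+1+y) M_0` as a product. The `M_i` are even in `y`, so the coefficients of `1, y, y²` in this
single identity give `M_0` and `M_1` at `y = 0`, and the `y²` coefficient of `M_1 + (x+1) M_0`;
nothing else is needed. -/

/-! ### Hypergeometric sums weighted by `binom(2n-k,n)`. -/

theorem cast_choose_two_mul_sub_succ (R : Type*) [CommRing R] {n k : ℕ} (hk : k ≤ n) :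
    ((n : R) + 1 - k) * ((2 * n + 1 - k).choose n : R)
      = (2 * n + 1 - k) * ((2 * n - k).choose n : R) := by
  obtain ⟨m, rfl⟩ := Nat.exists_eq_add_of_le hk
  have h := Nat.choose_mul_succ_eq (k + m + m) (k + m)
  rw [show k + m + m + 1 - (k + m) = m + 1 by omega] at h
  rw [show 2 * (k + m) + 1 - k = k + m + m + 1 by omega,
    show 2 * (k + m) - k = k + m + m by omega]
  have h' := congrArg (Nat.cast (R := R)) h
  push_cast at h' ⊢
  linear_combination -h'

theorem cast_choose_two_mul_succ_sub (R : Type*) [CommRing R] {n k : ℕ} (hk : k ≤ n) :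
    ((n : R) + 1) * ((2 * (n + 1) - k).choose (n + 1) : R)
      = (2 * n + 2 - k) * ((2 * n + 1 - k).choose n : R) := by
  obtain ⟨m, rfl⟩ := Nat.exists_eq_add_of_le hk
  have h := Nat.add_one_mul_choose_eq (k + m + m + 1) (k + m)
  rw [show 2 * (k + m + 1) - k = k + m + m + 1 + 1 by omega,
    show 2 * (k + m) + 1 - k = k + m + m + 1 by omega]
  have h' := congrArg (Nat.cast (R := R)) h
  push_cast at h' ⊢
  linear_combination -h'

/-- The first-order recurrence behind the terminating form of Watson's theorem. -/
theorem watson_sum_succ {R : Type*} [CommRing R] {a b c : R} (habc : a + b + 1 = 2 * c)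
    {v : ℕ → R} {n : ℕ}
    (hv : ∀ k ≤ n, ((k : R) + 1) * (c + k) * v (k + 1) = (a + k) * (b + k) * v k) :
    ((n : R) + 1) * (c + n) * ∑ k ∈ range (n + 1 + 1), ((2 * (n + 1) - k).choose (n + 1) : R) * v k
      = (a + 2 * n + 1) * (b + 2 * n + 1)
        * ∑ k ∈ range (n + 1), ((2 * n - k).choose n : R) * v k := by
  -- Zeilberger-style certificate `k(c+k-1) binom(2n+1-k,n) v_k`; its boundary value at `k = n+1`
  -- cancels the extra top term of the longer sum.
  have key : ∀ k ∈ range (n + 1),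
      ((n : R) + 1) * (c + n) * (((2 * (n + 1) - k).choose (n + 1) : R) * v k)
        - (a + 2 * n + 1) * (b + 2 * n + 1) * (((2 * n - k).choose n : R) * v k)
      = (k : R) * (c + k - 1) * ((2 * n + 1 - k).choose n : R) * v k
        - ((k + 1 : ℕ) : R) * (c + (k + 1 : ℕ) - 1) * ((2 * n + 1 - (k + 1)).choose n : R)
            * v (k + 1) := by
    intro k hk
    have hk : k ≤ n := by simpa [Nat.lt_succ_iff] using hk
    rw [show 2 * n + 1 - (k + 1) = 2 * n - k by omega]
    have h1 := cast_choose_two_mul_sub_succ R hk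
    have h2 := cast_choose_two_mul_succ_sub R hk
    have h3 := hv k hk
    have hb : b = 2 * c - 1 - a := by linear_combination habc
    subst hb
    push_cast
    linear_combination (c + n) * v k * h2 + ((2 * n - k).choose n : R) * h3
      + (2 * c + 2 * n + k) * v k * h1
  rw [sum_range_succ _ (n + 1), mul_add, mul_sum, mul_sum, ← sub_eq_zero]
  have hs := sum_congr rfl key
  rw [sum_sub_distrib, sum_range_sub'] at hs
  rw [add_sub_right_comm, hs, show 2 * n + 1 - (n + 1) = n by omega,
    show 2 * (n + 1) - (n + 1) = n + 1 by omega]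
  push_cast
  simp
  ring

/-- The weight is proportional to `(-n)_k/(-2n)_k`, so this is a terminating Watson ₃F₂.
Denominators are cleared so that it applies over `ℂ[X]`. -/
theorem watson_sum_eq_prod {R : Type*} [CommRing R] {a b c : R} (habc : a + b + 1 = 2 * c)
    {v : ℕ → R} {n : ℕ}
    (hv : ∀ k < n, ((k : R) + 1) * (c + k) * v (k + 1) = (a + k) * (b + k) * v k) :
    (n.factorial : R) * (∏ i ∈ range n, (c + i))
        * ∑ k ∈ range (n + 1), ((2 * n - k).choose n : R) * v k
      = v 0 * ∏ i ∈ range n, ((b + 2 * i + 1) * (a + 2 * i + 1)) := by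
  induction n with
  | zero => simp
  | succ n ih =>
    have h := watson_sum_succ habc (n := n) fun k hk => hv k (by omega)
    have ih := ih fun k hk => hv k (by omega)
    rw [prod_range_succ, prod_range_succ, Nat.factorial_succ]
    push_cast
    linear_combination (n.factorial : R) * (∏ i ∈ range n, (c + i)) * h
      + (a + 2 * n + 1) * (b + 2 * n + 1) * ih

/-- The summand telescopes. The `k³` terms of the cubic factor cancel, leaving a relation among the
moments of order 0, 1 and 2. -/
theorem sum_contiguous_eq_zero {R : Type*} [CommRing R] {a b c : R} {v : ℕ → R} {n : ℕ}
    (hv : ∀ k < n, ((k : R) + 1) * (c + k) * v (k + 1) = (a + k) * (b + k) * v k) :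
    ∑ k ∈ range (n + 1), ((2 * n - k).choose n : R)
      * (((n - k) * (a + k) * (b + k) - k * (c + k - 1) * (2 * n + 1 - k)) * v k) = 0 := by
  have key : ∀ k ∈ range n, ((2 * n - k).choose n : R)
      * (((n - k) * (a + k) * (b + k) - k * (c + k - 1) * (2 * n + 1 - k)) * v k)
      = ((k + 1 : ℕ) : R) * (c + (k + 1 : ℕ) - 1) * (2 * n + 1 - (k + 1 : ℕ))
          * ((2 * n - (k + 1)).choose n : R) * v (k + 1)
        - (k : R) * (c + k - 1) * (2 * n + 1 - k) * ((2 * n - k).choose n : R) * v k := by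
    intro k hk
    have hk : k < n := by simpa using hk
    obtain ⟨m, rfl⟩ := Nat.exists_eq_add_of_le' hk
    have h1 := Nat.choose_mul_succ_eq (m + (k + 1) + m) (m + (k + 1))
    rw [show m + (k + 1) + m + 1 - (m + (k + 1)) = m + 1 by omega] at h1
    have h1 := congrArg (Nat.cast (R := R)) h1
    have h3 := hv k hk
    rw [show 2 * (m + (k + 1)) - (k + 1) = m + (k + 1) + m by omega,
      show 2 * (m + (k + 1)) - k = m + (k + 1) + m + 1 by omega]
    push_cast at h1 ⊢
    linear_combination -((m : R) + 1) * ((m + (k + 1) + m + 1).choose (m + (k + 1)) : R) * h3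
      - ((k : R) + 1) * (c + k) * v (k + 1) * h1
  rw [sum_range_succ, sum_congr rfl key, sum_range_sub fun k : ℕ =>
    (k : R) * (c + k - 1) * (2 * n + 1 - k) * ((2 * n - k).choose n : R) * v k]
  push_cast
  ring

/-! ### Binomials as products, and low coefficients of products in `y`. -/

theorem Ring.factorial_mul_choose_add (z : ℂ) (m : ℕ) :
    (m.factorial : ℂ) * Ring.choose (z + m) m = ∏ i ∈ range m, (z + 1 + i) := by
  have h := Ring.descPochhammer_eq_factorial_smul_choose (z + m) m
  rw [nsmul_eq_mul] at h
  rw [← h, ← aeval_eq_smeval, ← eval_map_algebraMap, descPochhammer_map, descPochhammer_eval_eq_prod_range, ← prod_range_reflect]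
  refine prod_congr rfl fun i hi => ?_
  have hi : i < m := by simpa using hi
  rw [show m - 1 - i = m - (i + 1) by omega, Nat.cast_sub hi]
  push_cast
  ring

theorem genHarmonic_succ (l n : ℕ) (x : ℂ) :
    genHarmonic l (n + 1) x = genHarmonic l n x + 1 / (x + (n + 1 : ℕ)) ^ l := by
  rw [genHarmonic, sum_Icc_succ_top (by omega), genHarmonic]

theorem coeff_prod_one_sub_sq (x : ℂ) (k : ℕ) :
    (∏ i ∈ range k, (1 - C (1 / (x + (i + 1 : ℕ)) ^ 2) * X ^ 2) : ℂ[X]).coeff 0 = 1 ∧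
    (∏ i ∈ range k, (1 - C (1 / (x + (i + 1 : ℕ)) ^ 2) * X ^ 2) : ℂ[X]).coeff 1 = 0 ∧
    (∏ i ∈ range k, (1 - C (1 / (x + (i + 1 : ℕ)) ^ 2) * X ^ 2) : ℂ[X]).coeff 2
      = -genHarmonic 2 k x := by
  induction k with
  | zero => simp [genHarmonic, coeff_one]
  | succ k ih =>
    obtain ⟨h0, h1, h2⟩ := ih
    rw [prod_range_succ, genHarmonic_succ]
    generalize ∏ i ∈ range k, (1 - C (1 / (x + (i + 1 : ℕ)) ^ 2) * X ^ 2) = p at *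
    rw [mul_sub, mul_one, mul_left_comm]
    simp only [coeff_sub, coeff_C_mul, coeff_mul_X_pow', h0, h1, h2]
    simp
    ring

/-- The low coefficients of `∏_{1 ≤ i ≤ 2n+1} (x + i - (-1)^i y)`; the number `δ` is
`∑_{1 ≤ i ≤ 2n+1} (-1)^(i+1) / (x + i)`. -/
theorem coeff_prod_alternating (x : ℂ) (n : ℕ)
    (hx : ∀ k : ℕ, 1 ≤ k → k ≤ 2 * n + 1 → x + (k : ℂ) ≠ 0) :
    let P : ℂ[X] := (C (x + 1) + X) * ∏ i ∈ range n,
      ((C (x + 2 * i + 2) - X) * (C (x + 2 * i + 3) + X))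
    let p : ℂ := ∏ i ∈ range (2 * n + 1), (x + 1 + i)
    let δ : ℂ := (genHarmonic 1 (n + 1) ((x - 1) / 2) - genHarmonic 1 n (x / 2)) / 2
    P.coeff 0 = p ∧ P.coeff 1 = p * δ ∧
      P.coeff 2 = p * (δ ^ 2 - genHarmonic 2 (2 * n + 1) x) / 2 := by
  intro P p δ
  induction n with
  | zero =>
    have h := hx 1 le_rfl (by omega)
    push_cast at h
    have h' : (x - 1) / 2 + 1 = (x + 1) / 2 := by ring
    simp [P, p, δ, genHarmonic, coeff_X, coeff_one, h']
    constructor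
    · field_simp
    · field_simp
      ring
  | succ n ih =>
    obtain ⟨h0, h1, h2⟩ := ih fun k hk hk' => hx k hk (by omega)
    have g1 := hx (2 * n + 2) (by omega) (by omega)
    have g2 := hx (2 * n + 3) (by omega) (by omega)
    push_cast at g1 g2
    have hp : p = (∏ i ∈ range (2 * n + 1), (x + 1 + i)) * (x + (2 * n + 2)) * (x + (2 * n + 3)) := by
      simp only [p]
      rw [show 2 * (n + 1) + 1 = 2 * n + 1 + 1 + 1 by ring, prod_range_succ, prod_range_succ]
      push_cast
      ring
    have hδ : δ = (genHarmonic 1 (n + 1) ((x - 1) / 2) - genHarmonic 1 n (x / 2)) / 2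
        + 1 / (x + (2 * n + 3)) - 1 / (x + (2 * n + 2)) := by
      simp only [δ]
      rw [genHarmonic_succ 1 (n + 1), genHarmonic_succ 1 n (x / 2)]
      push_cast
      rw [show (x - 1) / 2 + ((n : ℂ) + 1 + 1) = (x + (2 * n + 3)) / 2 by ring,
        show x / 2 + ((n : ℂ) + 1) = (x + (2 * n + 2)) / 2 by ring]
      field_simp
      ring
    have hη : genHarmonic 2 (2 * (n + 1) + 1) x = genHarmonic 2 (2 * n + 1) x
        + 1 / (x + (2 * n + 2)) ^ 2 + 1 / (x + (2 * n + 3)) ^ 2 := by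
      rw [show 2 * (n + 1) + 1 = 2 * n + 1 + 1 + 1 by ring, genHarmonic_succ, genHarmonic_succ]
      push_cast
      ring
    rw [hp, hδ, hη]
    simp only [P]
    rw [prod_range_succ, ← mul_assoc]
    generalize (C (x + 1) + X) * ∏ i ∈ range n,
      ((C (x + 2 * i + 2) - X) * (C (x + 2 * i + 3) + X)) = Q at *
    generalize genHarmonic 2 (2 * n + 1) x = η at *
    generalize (genHarmonic 1 (n + 1) ((x - 1) / 2) - genHarmonic 1 n (x / 2)) / 2 = d at *
    generalize ∏ i ∈ range (2 * n + 1), (x + 1 + i) = r at *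
    have e : Q * ((C (x + 2 * n + 2) - X) * (C (x + 2 * n + 3) + X))
        = Q * C ((x + (2 * n + 2)) * (x + (2 * n + 3))) - C 1 * Q * X ^ 1 - Q * X ^ 2 := by
      simp only [C_add, C_mul, map_ofNat, C_1]
      ring
    rw [e]
    simp only [coeff_sub, coeff_C_mul, coeff_mul_C, coeff_mul_X_pow', h0, h1, h2]
    rw [show x + (2 * (n : ℂ) + 3) = x + (2 * n + 2) + 1 by ring] at g2 ⊢
    generalize x + (2 * (n : ℂ) + 2) = g at *
    refine ⟨?_, ?_, ?_⟩
    · simp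
      ring
    · simp
      field_simp
      ring
    · simp
      field_simp
      ring

/-! ### The deformed summand and its moments. -/

/-- The summand `binom (x + k, k) / (x + 1 + k) * ∏_{j ≤ k} (1 - y ^ 2 / (x + j) ^ 2)`, as a
polynomial in `y`. -/
noncomputable def deformedTerm (x : ℂ) (k : ℕ) : ℂ[X] :=
  C (Ring.choose (x + k) k / (x + 1 + k))
    * ∏ i ∈ range k, (1 - C (1 / (x + (i + 1 : ℕ)) ^ 2) * X ^ 2)

theorem deformedTerm_succ {x : ℂ} {k : ℕ} (h1 : x + 1 + k ≠ 0) (h2 : x + 2 + k ≠ 0) :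
    ((k : ℂ[X]) + 1) * (C (x + 2) + (k : ℂ[X])) * deformedTerm x (k + 1)
      = (C (x + 1) + X + (k : ℂ[X])) * (C (x + 1) - X + (k : ℂ[X])) * deformedTerm x k := by
  have hc : ((k : ℂ) + 1) * Ring.choose (x + (k + 1 : ℕ)) (k + 1)
      = (x + 1 + k) * Ring.choose (x + k) k := by
    have e1 := Ring.factorial_mul_choose_add x (k + 1)
    have e2 := Ring.factorial_mul_choose_add x k
    rw [prod_range_succ, ← e2, Nat.factorial_succ] at e1
    have hf : (k.factorial : ℂ) ≠ 0 := Nat.cast_ne_zero.mpr k.factorial_ne_zero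
    apply mul_left_cancel₀ hf
    push_cast at e1 ⊢
    linear_combination e1
  have h2' : x + 1 + (k + 1 : ℕ) ≠ 0 := by
    intro h
    apply h2
    push_cast at h
    linear_combination h
  have e1 : ((k : ℂ) + 1) * (x + 2 + k)
      * (Ring.choose (x + (k + 1 : ℕ)) (k + 1) / (x + 1 + (k + 1 : ℕ)))
      = (x + 1 + k) ^ 2 * (Ring.choose (x + k) k / (x + 1 + k)) := by
    rw [mul_div_assoc', mul_div_assoc', div_eq_div_iff h2' h1]
    push_cast at hc ⊢
    linear_combination (x + 2 + k) * (x + 1 + k) * hc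
  -- `e1` is the term ratio at `y = 0`; `e2` turns its factor `(x+1+k)²` times the new factor into
  -- `(x+1+k)² - y²`.
  have e2 : (x + 1 + k) ^ 2 * (1 / (x + (k + 1 : ℕ)) ^ 2) = 1 := by
    rw [show x + ((k + 1 : ℕ) : ℂ) = x + 1 + k by push_cast; ring]
    field_simp
  have e1 := congrArg (C : ℂ → ℂ[X]) e1
  have e2 := congrArg (C : ℂ → ℂ[X]) e2
  rw [deformedTerm, deformedTerm, prod_range_succ]
  generalize ∏ i ∈ range k, ((1 : ℂ[X]) - C (1 / (x + (i + 1 : ℕ)) ^ 2) * X ^ 2) = p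
  generalize Ring.choose (x + (k + 1 : ℕ)) (k + 1) / (x + 1 + (k + 1 : ℕ)) = h' at *
  generalize Ring.choose (x + k) k / (x + 1 + k) = h at *
  generalize 1 / (x + (k + 1 : ℕ)) ^ 2 = r at *
  simp only [C_add, C_mul, C_pow, C_1, map_ofNat, map_natCast] at e1 e2 ⊢
  linear_combination p * (1 - C r * X ^ 2) * e1 - C h * p * X ^ 2 * e2

theorem coeff_deformedTerm (x : ℂ) (k : ℕ) :
    (deformedTerm x k).coeff 1 = 0 ∧ (deformedTerm x k).coeff 2
      = -(Ring.choose (x + k) k / (x + 1 + k) * genHarmonic 2 k x) := by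
  obtain ⟨-, h1, h2⟩ := coeff_prod_one_sub_sq x k
  rw [deformedTerm, coeff_C_mul, coeff_C_mul, h1, h2]
  simp

/-- The moments `∑ binom (2 n - k, n) k ^ i u_k` of the deformed summand. -/
noncomputable def deformedMoment (n : ℕ) (x : ℂ) (i : ℕ) : ℂ[X] :=
  ∑ k ∈ range (n + 1), C (((2 * n - k).choose n : ℂ) * (k : ℂ) ^ i) * deformedTerm x k

theorem coeff_one_deformedMoment (n : ℕ) (x : ℂ) (i : ℕ) :
    (deformedMoment n x i).coeff 1 = 0 := by
  rw [deformedMoment, finsetSum_coeff]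
  refine sum_eq_zero fun k _ => ?_
  rw [coeff_C_mul, (coeff_deformedTerm x k).1, mul_zero]

/-- Multiplying by `x+1+k` undoes the denominator of the deformed term: `(x+1+k)k² = k³ + (x+1)k²`.
-/
theorem sum_choose_mul_genHarmonic_eq {n : ℕ} {x : ℂ}
    (hx : ∀ k : ℕ, 1 ≤ k → k ≤ 2 * n + 1 → x + (k : ℂ) ≠ 0) :
    ∑ k ∈ range (n + 1), ((2 * n - k).choose n : ℂ) * Ring.choose (x + (k : ℂ)) k * (k : ℂ) ^ 2
        * genHarmonic 2 k x
      = -((deformedMoment n x 3).coeff 2 + (x + 1) * (deformedMoment n x 2).coeff 2) := by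
  simp only [deformedMoment, finsetSum_coeff]
  rw [mul_sum, ← sum_add_distrib, ← sum_neg_distrib]
  refine sum_congr rfl fun k hk => ?_
  have hk : k ≤ n := by simpa [Nat.lt_succ_iff] using hk
  have h := hx (k + 1) (by omega) (by omega)
  rw [show x + ((k + 1 : ℕ) : ℂ) = x + 1 + k by push_cast; ring] at h
  rw [coeff_C_mul, coeff_C_mul, (coeff_deformedTerm x k).2]
  field_simp
  ring

/-! ### Relations among the moments. -/

theorem deformedTerm_succ_of_lt {n : ℕ} {x : ℂ}
    (hx : ∀ k : ℕ, 1 ≤ k → k ≤ 2 * n + 1 → x + (k : ℂ) ≠ 0) {k : ℕ} (hk : k < n) :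
    ((k : ℂ[X]) + 1) * (C (x + 2) + (k : ℂ[X])) * deformedTerm x (k + 1)
      = (C (x + 1) + X + (k : ℂ[X])) * (C (x + 1) - X + (k : ℂ[X])) * deformedTerm x k := by
  refine deformedTerm_succ (fun h => hx (k + 1) (by omega) (by omega) ?_)
    (fun h => hx (k + 2) (by omega) (by omega) ?_) <;>
  · push_cast
    linear_combination h

theorem deformedMoment_two {n : ℕ} {x : ℂ}
    (hx : ∀ k : ℕ, 1 ≤ k → k ≤ 2 * n + 1 → x + (k : ℂ) ≠ 0) :
    C (n + x + 2) * deformedMoment n x 2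
      = (n : ℂ[X]) * (C (x + 1) ^ 2 - X ^ 2) * deformedMoment n x 0
        - (C (x + 1) ^ 2 - X ^ 2 + C (x + 1)) * deformedMoment n x 1 := by
  have h := sum_contiguous_eq_zero (n := n) fun k hk => deformedTerm_succ_of_lt hx hk
  rw [← sub_eq_zero, ← neg_eq_zero, ← h]
  simp only [deformedMoment, mul_sum, ← sum_sub_distrib, ← sum_neg_distrib]
  refine sum_congr rfl fun k _ => ?_
  simp only [C_add, C_mul, C_pow, C_1, map_ofNat, map_natCast]
  ring

/-- The contiguous relation for `(x+1+k) u_k`, whose lower parameter is `x+1` instead of `x+2`. -/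
theorem deformedMoment_three {n : ℕ} {x : ℂ}
    (hx : ∀ k : ℕ, 1 ≤ k → k ≤ 2 * n + 1 → x + (k : ℂ) ≠ 0) :
    C (n + x + 3) * (deformedMoment n x 3 + C (x + 1) * deformedMoment n x 2)
      = (C (2 * n - x) - (C (x + 1) ^ 2 - X ^ 2))
          * (deformedMoment n x 2 + C (x + 1) * deformedMoment n x 1)
        + (n : ℂ[X]) * (C (x + 1) ^ 2 - X ^ 2)
          * (deformedMoment n x 1 + C (x + 1) * deformedMoment n x 0) := by
  have h := sum_contiguous_eq_zero (n := n) (a := C (x + 1) + X) (b := C (x + 1) - X)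
    (c := C (x + 1)) (v := fun k => (C (x + 1) + (k : ℂ[X])) * deformedTerm x k) fun k hk => by
      have h := deformedTerm_succ_of_lt hx hk
      simp only [C_add, C_1, map_ofNat] at h ⊢
      push_cast
      linear_combination (C x + 1 + (k : ℂ[X])) * h
  rw [← sub_eq_zero, ← neg_eq_zero, ← h]
  simp only [deformedMoment, mul_sum, ← sum_sub_distrib, ← sum_neg_distrib, ← sum_add_distrib]
  refine sum_congr rfl fun k _ => ?_
  simp only [C_add, C_sub, C_mul, C_pow, C_1, map_ofNat, map_natCast]
  ring

/-- Watson's sum for `(x+1+y+k) u_k`: this factor raises `a` to `x+2+y`, so that `a+b+1 = 2(x+2) =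
2c`. -/
theorem deformedMoment_one_add {n : ℕ} {x : ℂ}
    (hx : ∀ k : ℕ, 1 ≤ k → k ≤ 2 * n + 1 → x + (k : ℂ) ≠ 0) :
    C ((x + 1) * n.factorial * ∏ i ∈ range n, (x + 2 + i))
        * (deformedMoment n x 1 + (C (x + 1) + X) * deformedMoment n x 0)
      = (C (x + 1) + X) * ∏ i ∈ range n,
        ((C (x + 2 * i + 2) - X) * (C (x + 2 * i + 3) + X)) := by
  have h := watson_sum_eq_prod (n := n) (a := C (x + 2) + X) (b := C (x + 1) - X)
    (c := C (x + 2)) (v := fun k => (C (x + 1) + X + (k : ℂ[X])) * deformedTerm x k)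
    (by simp only [C_add, C_1, map_ofNat]; ring) fun k hk => by
      have h := deformedTerm_succ_of_lt hx hk
      simp only [C_add, C_1, map_ofNat] at h ⊢
      push_cast
      linear_combination (C x + 2 + X + (k : ℂ[X])) * h
  have h0 : C (x + 1) * deformedTerm x 0 = 1 := by
    have h1 := hx 1 le_rfl (by omega)
    push_cast at h1
    rw [deformedTerm, ← mul_assoc, ← C_mul]
    simp [h1]
  have hs : deformedMoment n x 1 + (C (x + 1) + X) * deformedMoment n x 0
      = ∑ k ∈ range (n + 1), ((2 * n - k).choose n : ℂ[X])
        * ((C (x + 1) + X + (k : ℂ[X])) * deformedTerm x k) := by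
    simp only [deformedMoment, mul_sum, ← sum_add_distrib]
    refine sum_congr rfl fun k _ => ?_
    simp only [C_mul, C_pow, map_natCast]
    ring
  have hp : ∏ i ∈ range n, ((C (x + 1) - X + 2 * (i : ℂ[X]) + 1) * (C (x + 2) + X + 2 * (i : ℂ[X]) + 1))
      = ∏ i ∈ range n, ((C (x + 2 * i + 2) - X) * (C (x + 2 * i + 3) + X)) := by
    refine prod_congr rfl fun i _ => ?_
    simp only [C_add, C_mul, C_1, map_ofNat, map_natCast]
    ring
  rw [hs, ← hp]
  simp only [C_mul, map_prod, C_add (b := ((_ : ℕ) : ℂ)), map_natCast] at h ⊢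
  simp only [Nat.cast_zero, add_zero] at h
  linear_combination C (x + 1) * h + (C (x + 1) + X) * (∏ i ∈ range n,
    ((C (x + 1) - X + 2 * (i : ℂ[X]) + 1) * (C (x + 2) + X + 2 * (i : ℂ[X]) + 1))) * h0

/-! ### Extraction of the closed form. -/

theorem prod_range_eq_choose {n : ℕ} (hn : 2 ≤ n) (x : ℂ) :
    (n * (n - 1) : ℂ) * ∏ i ∈ range (2 * n + 1), (x + 1 + i)
      = (x + 1) * (x + n + 2) * (x + n + 3) * Ring.choose (x + 2 * n + 1) (n - 2)
        * (n.factorial * ∏ i ∈ range n, (x + 2 + i)) := by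
  obtain ⟨m, rfl⟩ := Nat.exists_eq_add_of_le' hn
  have h := Ring.factorial_mul_choose_add (x + m + 5) m
  rw [show 2 * (m + 2) + 1 = m + 2 + 1 + 1 + 1 + m by ring, prod_range_add, prod_range_succ,
    prod_range_succ, prod_range_succ', Nat.add_sub_cancel]
  rw [show x + 2 * ((m + 2 : ℕ) : ℂ) + 1 = x + m + 5 + m by push_cast; ring]
  rw [show (m + 2).factorial = (m + 2) * ((m + 1) * m.factorial) by
    rw [Nat.factorial_succ, Nat.factorial_succ]]
  have e1 : ∏ i ∈ range m, (x + 1 + ((m + 2 + 1 + 1 + 1 + i : ℕ) : ℂ))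
      = ∏ i ∈ range m, (x + m + 5 + 1 + i) :=
    prod_congr rfl fun i _ => by push_cast; ring
  have e2 : ∏ i ∈ range (m + 2), (x + 1 + ((i + 1 : ℕ) : ℂ))
      = ∏ i ∈ range (m + 2), (x + 2 + i) :=
    prod_congr rfl fun i _ => by push_cast; ring
  rw [e1, e2, ← h]
  push_cast
  ring

theorem theorem6 (n : ℕ) (hn : 2 ≤ n) (x : ℂ)
    (hx : ∀ k : ℕ, 1 ≤ k → k ≤ 2 * n + 1 → x ≠ -(k : ℂ))
    (hq : x * (n : ℂ) + 3 * (n : ℂ) + 1 ≠ 0) :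
    (∑ k ∈ Finset.range (n + 1),
        ((2 * n - k).choose n : ℂ) * Ring.choose (x + (k : ℂ)) k * (k : ℂ) ^ 2
          * genHarmonic 2 k x)
      = (x + 1) * (x * (n : ℂ) + 3 * (n : ℂ) + 1) / (8 * ((n : ℂ) - 1))
          * Ring.choose (x + 2 * (n : ℂ) + 1) (n - 2)
          * (4 * genHarmonic 2 (2 * n + 1) x
              + 8 * (x ^ 2 + 3 * x + (n : ℂ) ^ 2 - (n : ℂ) + 1)
                  / ((n : ℂ) * (x + 1) * (x * (n : ℂ) + 3 * (n : ℂ) + 1))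
              - (genHarmonic 1 n (x / 2) - genHarmonic 1 (n + 1) ((x - 1) / 2))
                * (genHarmonic 1 n (x / 2) - genHarmonic 1 (n + 1) ((x - 1) / 2)
                    - 4 * (x + (n : ℂ) + 1) * (x ^ 2 + 3 * x - 2 * (n : ℂ) + 1)
                        / ((n : ℂ) * (x + 1) * (x * (n : ℂ) + 3 * (n : ℂ) + 1)))) := by
  have hx' : ∀ k : ℕ, 1 ≤ k → k ≤ 2 * n + 1 → x + (k : ℂ) ≠ 0 := fun k h1 h2 h =>
    hx k h1 h2 (eq_neg_of_add_eq_zero_left h)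
  have hx1 : x + 1 ≠ 0 := by simpa using hx' 1 le_rfl (by omega)
  have hN : (n : ℂ) + x + 2 ≠ 0 := fun h =>
    hx' (n + 2) (by omega) (by omega) (by push_cast; linear_combination h)
  have hN1 : (n : ℂ) + x + 3 ≠ 0 := fun h =>
    hx' (n + 3) (by omega) (by omega) (by push_cast; linear_combination h)
  have hn0 : (n : ℂ) ≠ 0 := Nat.cast_ne_zero.mpr (by omega)
  have hn1 : (n : ℂ) - 1 ≠ 0 := sub_ne_zero.mpr (by exact_mod_cast (by omega : n ≠ 1))
  rw [sum_choose_mul_genHarmonic_eq hx']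
  have hK0 : (x + 1) * n.factorial * ∏ i ∈ range n, (x + 2 + (i : ℂ)) ≠ 0 := by
    refine mul_ne_zero (mul_ne_zero hx1 (Nat.cast_ne_zero.mpr n.factorial_ne_zero))
      (prod_ne_zero_iff.mpr fun i hi h => ?_)
    have hi : i < n := by simpa using hi
    exact hx' (i + 2) (by omega) (by omega) (by push_cast; linear_combination h)
  obtain ⟨c0, c1, c2⟩ := coeff_prod_alternating x n hx'
  have h2 := deformedMoment_two hx'
  have h3 := deformedMoment_three hx'
  have hp := prod_range_eq_choose hn x
  have hU := coeff_one_deformedMoment n x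
  rw [← deformedMoment_one_add hx', coeff_C_mul] at c0 c1 c2
  -- Evenness in `y`: with these linear coefficients zero, `c1` isolates the constant term of `M_0`.
  have a1 := hU 0
  have b1 := hU 1
  generalize deformedMoment n x 0 = U₀ at *
  generalize deformedMoment n x 1 = U₁ at *
  generalize deformedMoment n x 2 = U₂ at *
  generalize deformedMoment n x 3 = U₃ at *
  clear hU
  generalize hK : (x + 1) * n.factorial * ∏ i ∈ range n, (x + 2 + (i : ℂ)) = K at *
  generalize ∏ i ∈ range (2 * n + 1), (x + 1 + (i : ℂ)) = p at *
  generalize Ring.choose (x + 2 * (n : ℂ) + 1) (n - 2) = B at *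
  generalize genHarmonic 1 n (x / 2) = s at *
  generalize genHarmonic 1 (n + 1) ((x - 1) / 2) = t at *
  generalize genHarmonic 2 (2 * n + 1) x = η at *
  -- `β` absorbs `n(n-1)`, making `p / K` polynomial in `n`, `x` and `β`.
  obtain ⟨β, hβ⟩ : ∃ β, B = β * (n * (n - 1)) := ⟨B / (n * (n - 1)), by field_simp⟩
  have hp' : p = K * (((n : ℂ) + x + 2) * (n + x + 3) * β) := by
    apply mul_left_cancel₀ (mul_ne_zero hn0 hn1)
    rw [hp, hβ, ← hK]
    ring
  rw [hp'] at c0 c1 c2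
  simp only [mul_assoc, mul_div_assoc] at c0 c1 c2
  have c0 := mul_left_cancel₀ hK0 c0
  have c1 := mul_left_cancel₀ hK0 c1
  have c2 := mul_left_cancel₀ hK0 c2
  have e2 : C ((n : ℂ) + x + 2) * U₂
      = C (n * (x + 1) ^ 2) * U₀ - C (n : ℂ) * U₀ * X ^ 2
        - C ((x + 1) ^ 2 + (x + 1)) * U₁ + U₁ * X ^ 2 := by
    rw [h2]
    simp only [C_add, C_mul, C_pow, C_1, map_natCast]
    ring
  have e3 : C ((n : ℂ) + x + 3) * (U₃ + C (x + 1) * U₂)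
      = C (2 * n - x - (x + 1) ^ 2) * U₂ + U₂ * X ^ 2
        + C ((2 * n - x - (x + 1) ^ 2) * (x + 1) + n * (x + 1) ^ 2) * U₁
        + C (x + 1 - n) * U₁ * X ^ 2
        + C (n * (x + 1) ^ 3) * U₀ - C (n * (x + 1)) * U₀ * X ^ 2 := by
    rw [h3]
    simp only [C_add, C_sub, C_mul, C_pow, C_1, map_natCast, map_ofNat]
    ring
  -- The constant term of `M_2` enters through the `y² M_2` term of `e3`.
  have e20 := congrArg (fun q => q.coeff 0) e2
  have e22 := congrArg (fun q => q.coeff 2) e2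
  have e32 := congrArg (fun q => q.coeff 2) e3
  simp only [coeff_add, coeff_sub, coeff_C_mul, coeff_mul_X_pow', add_mul, mul_add,
    coeff_X_mul, mul_coeff_zero, coeff_X_zero, coeff_C_zero] at c0 c1 c2 e20 e22 e32
  norm_num [a1, b1] at c0 c1 c2 e20 e22 e32
  have hR : (x + 1) * (x * n + 3 * n + 1) / (8 * (n - 1)) * B
      * (4 * η + 8 * (x ^ 2 + 3 * x + n ^ 2 - n + 1) / (n * (x + 1) * (x * n + 3 * n + 1))
        - (s - t) * (s - t - 4 * (x + n + 1) * (x ^ 2 + 3 * x - 2 * n + 1)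
            / (n * (x + 1) * (x * n + 3 * n + 1))))
      = β / 8 * (n * (x + 1) * (x * n + 3 * n + 1) * (4 * η - (s - t) ^ 2)
          + 8 * (x ^ 2 + 3 * x + n ^ 2 - n + 1)
          + 4 * (s - t) * (x + n + 1) * (x ^ 2 + 3 * x - 2 * n + 1)) := by
    rw [hβ]
    generalize x * (n : ℂ) + 3 * n + 1 = q at hq ⊢
    field_simp
    ring
  rw [hR]
  apply mul_left_cancel₀ (mul_ne_zero hN hN1)
  -- After eliminating `M_2`, the `y²` coefficients of `M_0` and `M_1` occur in ratio `x+1 : 1`, so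
  -- `c2` alone removes both; `c0` and `c1` supply the constant terms.
  linear_combination -(((n : ℂ) + x + 2) * e32 + (2 * n - x - (x + 1) ^ 2) * e22 + e20
    + ((n + x + 2) * ((2 * n - x - (x + 1) ^ 2) * (x + 1) + n * (x + 1) ^ 2)
        - (2 * n - x - (x + 1) ^ 2) * ((x + 1) ^ 2 + (x + 1))) * c2
    + (2 * n - x - (x + 1) ^ 2 - ((x + 1) ^ 2 + (x + 1)) + (n + x + 2) * (x + 1 - n)) * c0
    + (n * (x + 1) ^ 2 - n * (2 * n - x - (x + 1) ^ 2) - n * (n + x + 2) * (x + 1)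
        - (x + 1) * (2 * n - x - (x + 1) ^ 2 - ((x + 1) ^ 2 + (x + 1))
          + (n + x + 2) * (x + 1 - n))) * c1)
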